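/- Assume the Continuum Hypothesis $2^{\aleph_0}=\aleph_1$. Here every Lindelöf space is regular by definition (and regular spaces are $T_1$): a space is called Lindelöf if it is regular, $T_1$, and each of its open covers has a countable subcover. Let $X$ be a topological space such that - $X$ is productively Lindelöf, that is, $X\times Y$ is Lindelöf for every Lindelöf space $Y$; and - $X$ has countable tightness, that is, whenever $A\subseteq X$ and $x\in\overline{A}$, there is a countable set $B\subseteq A$ with $x\in\overline{B}$. Then $X$ is powerfully Lindelöf, that is, the countably infinite power $X^{\omega}$ with the product topology is Lindelöf. -/

import Mathlib

universe u

/-- A *Lindelöf space*, with the convention that Lindelöf spaces are regular and that regular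
spaces are `T₁` (so regular is Mathlib's `T3Space`): a regular space in which every open cover
has a countable subcover. Mathlib's `LindelofSpace` has no separation axiom. -/
structure IsRegularLindelof (X : Type*) [TopologicalSpace X] : Prop where
  regular : T3Space X
  lindelof : LindelofSpace X

/-- `X` is *productively Lindelöf* if `X × Y` is Lindelöf for every Lindelöf space `Y`. -/
def IsProductivelyLindelof (X : Type u) [TopologicalSpace X] : Prop :=
  ∀ (Y : Type u) [TopologicalSpace Y], IsRegularLindelof Y → IsRegularLindelof (X × Y)

/-- `X` is *powerfully Lindelöf* if the countably infinite power `X ^ ω`, with the product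
topology, is Lindelöf. -/
def IsPowerfullyLindelof (X : Type*) [TopologicalSpace X] : Prop :=
  IsRegularLindelof (ℕ → X)

/-- `X` has *countable tightness*: every point in the closure of a set `A` lies in the closure of
a countable subset of `A`. -/
def HasCountableTightness (X : Type*) [TopologicalSpace X] : Prop :=
  ∀ (A : Set X) (x : X), x ∈ closure A → ∃ B : Set X, B ⊆ A ∧ B.Countable ∧ x ∈ closure B

/-- The *Continuum Hypothesis*: the cardinality of the continuum is the first uncountable
cardinal. -/
def ContinuumHypothesis : Prop :=
  Cardinal.continuum.{0} = Cardinal.aleph.{0} 1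

/-!
Under the Continuum Hypothesis a productively Lindelöf space `X` of countable tightness has a
Lindelöf countable power.

Fix a well-ordered set `I` of cardinality `𝔠` with countable initial segments; `CH` provides it.

*Separation.* Suppose `X` is mapped continuously into `Z`, and `T ⊆ Z` is a Lindelöf set missing the
image such that, up to enlargement, the closed sets disjoint from `T` form an `I`-indexed increasing
family. Refining `T ∪ {z_i}` by a discrete part, for points `z_i` of the image outside the `i`-th
member, gives a Lindelöf space whose product with `X` contains a closed set with an uncountable
partition into relatively open pieces; hence some member of the family covers the image
(`IsProductivelyLindelof.exists_range_subset`). Taking for `Z` a compact metrizable space and for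
`T` the complement of the image, the image of `X` is `σ`-compact
(`IsProductivelyLindelof.exists_iUnion_eq_range`).

*Alster's property.* Let `φ : X → I → J` be continuous with `J` compact metrizable. Then every
family of `Gδ` sets which captures each compact subset of `range φ` has a countable subfamily
covering `range φ` (`IsProductivelyLindelof.hasAlsterProperty_range`). This is the separation lemma
with `T = ⋃ δ, {z ∉ O δ | z|δ ∉ (range φ)|δ}`, where, once the family has been shrunk to at most `𝔠`
closed cylinders, `O δ` is the union of the members of the family which have index below `δ` and
depend on coordinates below `δ` only. The point is that a closed set `K` disjoint from `T` lies in
some `O δ`: otherwise, for each `δ`, the set `K \ O δ` restricted to `δ` is covered by the countably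
many compact pieces of `(range φ)|δ`, the Baire category theorem localises one piece on a basic open
set, a pressing-down argument makes this basic set and the number of the piece the same for
unboundedly many `δ`, and the intersection of the corresponding cylinders is a compact subset of
`range φ`, hence inside one member of the family: a contradiction.

*Powers.* Alster's property of `Q` makes `Q ^ ω` Lindelöf (`HasAlsterProperty.isLindelof_pi`). Hence
a cover of `F ^ ω`, for `F` productively Lindelöf, by boxes of cozero sets has a countable subcover
as soon as at most `𝔠` continuous functions occur in it
(`IsProductivelyLindelof.exists_countable_cover`).

*Reflection.* Given a cover of `X ^ ω` by cozero boxes, each separable closed subspace `S`, the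
closure of the range of a sequence, has at most `𝔠` continuous functions to `[0, 1]`, so countably
many boxes cover `S ^ ω`.
Close off a set `D ⊆ X` of size at most `𝔠` under the operation which takes a countable list of
boxes so selected from sequences in `D` to the coordinates of a point of `X ^ ω` missed by these
boxes, if there is one. By countable tightness the at most `𝔠` many boxes selected from sequences in
`D` cover `(closure D) ^ ω`, so countably many of them do. These cover all of `X ^ ω`, as otherwise
they would miss a point of `D ^ ω`.
-/

open Set Topology Cardinal

/-! ### Separating the image of a productively Lindelöf space from a Lindelöf set -/

theorem IsProductivelyLindelof.isRegularLindelof {X : Type u} [TopologicalSpace X]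
    (hX : IsProductivelyLindelof X) : IsRegularLindelof X := by
  have h := hX PUnit.{u + 1} ⟨inferInstance, inferInstance⟩
  have := h.regular
  have := h.lindelof
  have e : X ≃ₜ X × PUnit.{u + 1} := (Homeomorph.prodPUnit X).symm
  exact ⟨e.isEmbedding.t3Space, e.isClosedEmbedding.LindelofSpace⟩

/-- Productive Lindelöfness passes to closed subspaces. -/
theorem IsProductivelyLindelof.subtype {X : Type u} [TopologicalSpace X]
    (hX : IsProductivelyLindelof X) {F : Set X} (hF : IsClosed F) :
    IsProductivelyLindelof F := by
  intro Y _ hY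
  have := hX.isRegularLindelof.regular
  have := hY.regular
  have := (hX Y hY).lindelof
  exact ⟨inferInstance, (hF.isClosedEmbedding_subtypeVal.prodMap
    Topology.IsClosedEmbedding.id).LindelofSpace⟩

theorem Set.Countable.exists_forall_lt {I : Type u} [LinearOrder I] [Uncountable I]
    (hI : ∀ i : I, (Iio i).Countable) {D : Set I} (hD : D.Countable) : ∃ i, ∀ j ∈ D, j < i := by
  by_contra! h
  have : (univ : Set I) ⊆ ⋃ j ∈ D, Iic j := fun i _ => by
    obtain ⟨j, hj, hij⟩ := h i
    exact mem_biUnion hj hij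
  refine not_countable_univ (α := I) ((hD.biUnion fun j _ => ?_).mono this)
  rw [← Iio_insert]
  exact (hI j).insert j

/-- If, in the sense of `hC`, closed sets disjoint from the Lindelöf set `T` are captured by the
initial unions of `C`, then the range of `φ`, although not closed, is captured as well. If not, pick
`φ (x i)` outside `⋃ j < i, C j`; the points `φ (x i)`, made isolated, form together with `T` a
Lindelöf space `Y`, and the graph of `φ` is a closed subset of `X × Y` which has an open cover with
no countable subcover. -/
theorem IsProductivelyLindelof.exists_range_subset {X Z I : Type u} [TopologicalSpace X]
    [TopologicalSpace Z] [T3Space Z] [LinearOrder I] [Uncountable I]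
    (hI : ∀ i : I, (Iio i).Countable) (hX : IsProductivelyLindelof X) {φ : X → Z}
    (hφ : Continuous φ) {T : Set Z} (hT : IsLindelof T) (hd : Disjoint T (range φ))
    (C : I → Set Z) (hC : ∀ V, IsOpen V → T ⊆ V → ∃ i, Vᶜ ⊆ ⋃ j < i, C j) :
    ∃ i, range φ ⊆ ⋃ j < i, C j := by
  classical
  by_contra! hcon
  have hx : ∀ i, ∃ x, φ x ∉ ⋃ j < i, C j := fun i => by
    obtain ⟨_, ⟨x, rfl⟩, hx⟩ := not_subset.1 (hcon i)
    exact ⟨x, hx⟩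
  choose x hx using hx
  let a : I → Z × (I → Bool) := fun i => (φ (x i), fun j => decide (j = i))
  let t₀ : Z → Z × (I → Bool) := fun z => (z, fun _ => false)
  -- The second coordinate isolates each `a i`, while a neighbourhood of `t₀ z` catches all `a i`
  -- with `φ (x i)` near `z` except finitely many.
  let Y : Set (Z × (I → Bool)) := t₀ '' T ∪ range a
  have hY : IsLindelof Y := by
    refine isLindelof_of_countable_subcover fun {ι} U hU hYU => ?_
    have h1 : ∀ t : T, ∃ k : ι, ∃ V : Set Z, ∃ F : Finset I, IsOpen V ∧ t.1 ∈ V ∧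
        ∀ z ∈ V, ∀ f : I → Bool, (∀ j ∈ F, f j = false) → (z, f) ∈ U k := by
      intro t
      obtain ⟨k, hk⟩ := mem_iUnion.1 (hYU (Or.inl ⟨t.1, t.2, rfl⟩))
      obtain ⟨V, W, hV, hW, htV, htW, hVW⟩ := isOpen_prod_iff.1 (hU k) t.1 (fun _ => false) hk
      obtain ⟨F, w, hw, hFw⟩ := isOpen_pi_iff.1 hW _ htW
      refine ⟨k, V, F, hV, htV, fun z hz f hf => hVW ⟨hz, hFw fun j hj => ?_⟩⟩
      have : f j ∈ w j := by rw [hf j hj]; exact (hw j hj).2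
      exact this
    choose k V F hV htV hVU using h1
    obtain ⟨c, hc, hTc⟩ := hT.elim_countable_subcover V hV
      fun z hz => mem_iUnion.2 ⟨⟨z, hz⟩, htV _⟩
    obtain ⟨i, hi⟩ := hC (⋃ t ∈ c, V t) (isOpen_biUnion fun t _ => hV t) hTc
    let B : Set I := Iio i ∪ ⋃ t ∈ c, (F t : Set I)
    have hB : B.Countable := (hI i).union (hc.biUnion fun t _ => (F t).countable_toSet)
    have h2 : ∀ j, ∃ k, a j ∈ U k := fun j => mem_iUnion.1 (hYU (Or.inr ⟨j, rfl⟩))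
    choose m hm using h2
    refine ⟨k '' c ∪ m '' B, (hc.image k).union (hB.image m), ?_⟩
    rintro _ (⟨z, hz, rfl⟩ | ⟨j, rfl⟩)
    · obtain ⟨t, ht, hzt⟩ := mem_iUnion₂.1 (hTc hz)
      exact mem_biUnion (Or.inl ⟨t, ht, rfl⟩) (hVU t z hzt _ fun _ _ => rfl)
    · by_cases hj : j ∈ B
      · exact mem_biUnion (Or.inr ⟨j, hj, rfl⟩) (hm j)
      · have hjV : φ (x j) ∈ ⋃ t ∈ c, V t := by
          by_contra hjV
          obtain ⟨l, hl, hjl⟩ := mem_iUnion₂.1 (hi hjV)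
          have hij : i ≤ j := not_lt.1 fun h => hj (Or.inl h)
          exact hx j (mem_biUnion (lt_of_lt_of_le hl hij : l < j) hjl)
        obtain ⟨t, ht, hjt⟩ := mem_iUnion₂.1 hjV
        refine mem_biUnion (Or.inl ⟨t, ht, rfl⟩) (hVU t _ hjt _ fun l hl => ?_)
        refine decide_eq_false fun hlj => hj (Or.inr (mem_biUnion ht ?_))
        exact hlj ▸ hl
  have hXY := (hX Y ⟨inferInstance, isLindelof_iff_lindelofSpace.1 hY⟩).lindelof
  -- As `T` misses the range of `φ`, the graph of `φ` meets only fibres over isolated points.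
  let E : Set (X × Y) := {p | φ p.1 = p.2.1.1}
  have hE : IsClosed E := isClosed_eq (hφ.comp continuous_fst)
    (continuous_fst.comp (continuous_subtype_val.comp continuous_snd))
  let W : I → Set (X × Y) := fun i => {p | p.2.1.2 i = true}
  have hW : ∀ i, IsOpen (W i) := fun i =>
    (isOpen_discrete {true}).preimage (f := fun p : X × Y => p.2.1.2 i)
      ((continuous_apply i).comp
        (continuous_snd.comp (continuous_subtype_val.comp continuous_snd)))
  have hEW : E ⊆ ⋃ i, W i := by
    rintro ⟨y, ⟨_, ⟨z, hz, rfl⟩ | ⟨j, rfl⟩⟩⟩ hp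
    · exact (hd.le_bot ⟨hz, y, hp⟩).elim
    · exact mem_iUnion.2 ⟨j, decide_eq_true rfl⟩
  obtain ⟨c, hc, hEc⟩ := hE.isLindelof.elim_countable_subcover W hW hEW
  refine not_countable_univ (α := I) (hc.mono fun i _ => ?_)
  have hi : ((x i, ⟨a i, Or.inr ⟨i, rfl⟩⟩) : X × Y) ∈ E := rfl
  obtain ⟨j, hj, hij⟩ := mem_iUnion₂.1 (hEc hi)
  have : j = i := of_decide_eq_true hij
  exact this ▸ hj

/-! ### Compact subsets of products, and `σ`-compact images -/

/-- Perfect preimages of Lindelöf sets are Lindelöf; in a hereditarily Lindelöf space this applies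
to all sets. -/
theorem Continuous.isLindelof_preimage {Z W : Type*} [TopologicalSpace Z] [TopologicalSpace W]
    [CompactSpace Z] [T2Space W] [HereditarilyLindelofSpace W] {f : Z → W} (hf : Continuous f)
    (B : Set W) : IsLindelof (f ⁻¹' B) := by
  refine isLindelof_of_countable_subcover fun {ι} U hU hBU => ?_
  have h1 : ∀ b : B, ∃ t : Finset ι, f ⁻¹' {b.1} ⊆ ⋃ k ∈ t, U k := fun b =>
    (isClosed_singleton.preimage hf).isCompact.elim_finite_subcover U hU
      ((preimage_mono (singleton_subset_iff.2 b.2)).trans hBU)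
  choose t ht using h1
  let V : B → Set W := fun b => (f '' (⋃ k ∈ t b, U k)ᶜ)ᶜ
  have hV : ∀ b, IsOpen (V b) := fun b =>
    (hf.isClosedMap _ (isOpen_biUnion fun k _ => hU k).isClosed_compl).isOpen_compl
  obtain ⟨c, hc, hBc⟩ := (HereditarilyLindelofSpace.isLindelof B).elim_countable_subcover V hV
    fun b hb => mem_iUnion.2 ⟨⟨b, hb⟩, by
      rintro ⟨z, hz, rfl⟩
      exact hz (ht ⟨f z, hb⟩ rfl)⟩
  refine ⟨⋃ b ∈ c, (t b : Set ι), hc.biUnion fun b _ => (t b).countable_toSet, fun z hz => ?_⟩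
  obtain ⟨b, hb, hzb⟩ := mem_iUnion₂.1 (hBc hz)
  have : z ∈ ⋃ k ∈ t b, U k := by
    by_contra h
    exact hzb ⟨z, h, rfl⟩
  obtain ⟨k, hk, hzk⟩ := mem_iUnion₂.1 this
  exact mem_biUnion (mem_biUnion hb hk) hzk

/-- A neighbourhood of a compact subset of a product contains a neighbourhood depending on finitely
many coordinates. -/
theorem IsCompact.exists_finset_forall_mem {I : Type*} {J : I → Type*}
    [∀ i, TopologicalSpace (J i)] {K U : Set (∀ i, J i)} (hK : IsCompact K) (hU : IsOpen U)
    (hKU : K ⊆ U) : ∃ F : Finset I, ∀ k ∈ K, ∀ z, (∀ i ∈ F, z i = k i) → z ∈ U := by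
  classical
  have h1 : ∀ k : K, ∃ F : Finset I, ∃ V : Set (∀ i, J i), IsOpen V ∧ k.1 ∈ V ∧
      ∀ k' ∈ V, ∀ z, (∀ i ∈ F, z i = k' i) → z ∈ U := by
    intro k
    obtain ⟨F, w, hw, hFw⟩ := isOpen_pi_iff.1 hU _ (hKU k.2)
    refine ⟨F, (F : Set I).pi w, isOpen_set_pi F.finite_toSet fun i hi => (hw i hi).1,
      fun i hi => (hw i hi).2, fun k' hk' z hz => hFw fun i hi => ?_⟩
    rw [hz i hi]
    exact hk' i hi
  choose F V hV hkV hVU using h1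
  obtain ⟨t, ht⟩ := hK.elim_finite_subcover V hV fun k hk => mem_iUnion.2 ⟨⟨k, hk⟩, hkV _⟩
  refine ⟨t.biUnion F, fun k hk z hz => ?_⟩
  obtain ⟨l, hl, hkl⟩ := mem_iUnion₂.1 (ht hk)
  exact hVU l k hkl z fun i hi => hz i (Finset.mem_biUnion.2 ⟨l, hl, hi⟩)

/-- A `Gδ` set around a compact subset of a product contains a cylinder around it which depends on
an initial segment of coordinates. -/
theorem IsCompact.exists_forall_mem_of_isGδ {I : Type u} [LinearOrder I] [Uncountable I]
    (hI : ∀ i : I, (Iio i).Countable) {J : I → Type*} [∀ i, TopologicalSpace (J i)]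
    {K G : Set (∀ i, J i)} (hK : IsCompact K) (hG : IsGδ G) (hKG : K ⊆ G) :
    ∃ δ : I, ∀ k ∈ K, ∀ z, (∀ i < δ, z i = k i) → z ∈ G := by
  obtain ⟨U, hU, rfl⟩ := isGδ_iff_eq_iInter_nat.1 hG
  choose F hF using fun n =>
    hK.exists_finset_forall_mem (hU n) (hKG.trans (iInter_subset _ n))
  obtain ⟨δ, hδ⟩ := Set.Countable.exists_forall_lt hI
    (countable_iUnion fun n => (F n).countable_toSet)
  exact ⟨δ, fun k hk z hz => mem_iInter.2 fun n =>
    hF n k hk z fun i hi => hz i (hδ i (mem_iUnion.2 ⟨n, hi⟩))⟩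

theorem Cardinal.mk_setOf_isClosed_le (W : Type u) [TopologicalSpace W]
    [SecondCountableTopology W] : #{C : Set W | IsClosed C} ≤ 𝔠 := by
  let f : Set (TopologicalSpace.countableBasis W) → Set W := fun s => (⋃ b ∈ s, b.1)ᶜ
  have h : {C : Set W | IsClosed C} ⊆ range f := by
    intro C hC
    obtain ⟨S, hS, hCS⟩ := (TopologicalSpace.isBasis_countableBasis W).open_eq_sUnion
      (IsClosed.isOpen_compl (s := C) (self := hC))
    refine ⟨{b | b.1 ∈ S}, ?_⟩
    rw [compl_eq_comm, hCS]
    ext x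
    simp only [mem_sUnion, mem_iUnion, mem_ofPred_eq, exists_prop, Subtype.exists]
    exact ⟨fun ⟨s, hs, hx⟩ => ⟨s, hS hs, hs, hx⟩, fun ⟨s, _, hs, hx⟩ => ⟨s, hs, hx⟩⟩
  refine (mk_le_mk_of_subset h).trans (mk_range_le.trans ?_)
  rw [mk_set, ← two_power_aleph0]
  exact power_le_power_left two_ne_zero
    (le_aleph0_iff_set_countable.2 (TopologicalSpace.countable_countableBasis W))

theorem Cardinal.exists_range_eq {α I : Type u} {S : Set α} (hS : S.Nonempty)
    (h : #S ≤ #I) : ∃ e : I → α, range e = S := by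
  obtain ⟨g⟩ := h
  have := hS.to_subtype
  refine ⟨fun i => (Function.invFun g i).1, ?_⟩
  rw [range_comp' Subtype.val, (Function.invFun_surjective g.injective).range_eq]
  simp

/-- Continuous images of productively Lindelöf spaces in a second countable space are `Fσ`, so
`σ`-compact if `W` is compact; the hypotheses on `I` amount to `CH`. The complement of the image is
Lindelöf, and at most `𝔠` closed sets avoid it. -/
theorem IsProductivelyLindelof.exists_iUnion_eq_range {X W I : Type u} [TopologicalSpace X]
    [TopologicalSpace W] [T3Space W] [SecondCountableTopology W] [LinearOrder I] [Uncountable I]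
    (hI : ∀ i : I, (Iio i).Countable) (hc : 𝔠 ≤ #I) (hX : IsProductivelyLindelof X) {φ : X → W}
    (hφ : Continuous φ) : ∃ K : ℕ → Set W, (∀ n, IsClosed (K n)) ∧ ⋃ n, K n = range φ := by
  obtain ⟨C, hC⟩ := Cardinal.exists_range_eq (I := I)
    (S := {C : Set W | IsClosed C ∧ C ⊆ range φ}) ⟨∅, isClosed_empty, empty_subset _⟩
    (((mk_le_mk_of_subset fun C hC => hC.1).trans
      (Cardinal.mk_setOf_isClosed_le W)).trans hc)
  have hC' : ∀ i, IsClosed (C i) ∧ C i ⊆ range φ := fun i => by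
    have : C i ∈ range C := ⟨i, rfl⟩
    rwa [hC] at this
  obtain ⟨i, hi⟩ := hX.exists_range_subset hI hφ
    (HereditarilyLindelofSpace.isLindelof (range φ)ᶜ) disjoint_compl_left C fun V hV hTV => by
      have : Vᶜ ∈ range C := hC ▸ ⟨hV.isClosed_compl, compl_subset_comm.1 hTV⟩
      obtain ⟨j, hj⟩ := this
      obtain ⟨i, hi⟩ := Set.Countable.exists_forall_lt hI (countable_singleton j)
      exact ⟨i, hj ▸ subset_biUnion_of_mem (u := C) (hi j rfl)⟩
  obtain ⟨K, hK⟩ := ((hI i).image C |>.insert ∅).exists_eq_range (insert_nonempty _ _)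
  have hKC : ∀ n, IsClosed (K n) ∧ K n ⊆ range φ := fun n => by
    have : K n ∈ insert ∅ (C '' Iio i) := hK ▸ ⟨n, rfl⟩
    rcases this with h | ⟨j, -, h⟩
    · rw [h]
      exact ⟨isClosed_empty, empty_subset _⟩
    · exact h ▸ hC' j
  refine ⟨K, fun n => (hKC n).1, (iUnion_subset fun n => (hKC n).2).antisymm fun w hw => ?_⟩
  obtain ⟨j, hj, hwj⟩ := mem_iUnion₂.1 (hi hw)
  have : C j ∈ range K := hK ▸ Or.inr ⟨j, hj, rfl⟩
  obtain ⟨n, hn⟩ := this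
  exact mem_iUnion.2 ⟨n, hn ▸ hwj⟩

/-- Baire category for the set `K \ ⋃ i, G i`, a `Gδ` subset of `K`: if countably many closed sets
cover it, one of them contains a nonempty relatively open part of it. -/
theorem IsClosed.exists_isOpen_inter_diff_subset {W : Type*} [TopologicalSpace W] [CompactSpace W]
    [T2Space W] {ι κ : Type*} [Countable ι] [Countable κ] {K : Set W} (hK : IsClosed K)
    {G : ι → Set W} (hG : ∀ i, IsClosed (G i)) {C : κ → Set W} (hC : ∀ n, IsClosed (C n))
    (hne : (K \ ⋃ i, G i).Nonempty) (hKC : K \ ⋃ i, G i ⊆ ⋃ n, C n) :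
    ∃ U, IsOpen U ∧ ∃ n, (U ∩ (K \ ⋃ i, G i)).Nonempty ∧ U ∩ (K \ ⋃ i, G i) ⊆ C n := by
  set S := K \ ⋃ i, G i with hS
  have : CompactSpace (closure S) := isCompact_iff_compactSpace.1 isClosed_closure.isCompact
  have : Nonempty (closure S) := (hne.mono subset_closure).to_subtype
  have hSK : closure S ⊆ K := hK.closure_subset_iff.2 sdiff_subset
  -- The sets `G i` have empty interior in `closure S`, so the piece with interior is a `C n`.
  let D : ι ⊕ κ → Set (closure S) := fun o => Subtype.val ⁻¹' Sum.elim G C o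
  obtain ⟨o, x, hx⟩ := nonempty_interior_of_iUnion_of_closed (f := D)
    (by
      rintro (i | n)
      · exact (hG i).preimage continuous_subtype_val
      · exact (hC n).preimage continuous_subtype_val)
    (by
      refine eq_univ_of_forall fun x => ?_
      by_cases hxG : x.1 ∈ ⋃ i, G i
      · obtain ⟨i, hi⟩ := mem_iUnion.1 hxG
        exact mem_iUnion.2 ⟨.inl i, hi⟩
      · obtain ⟨n, hn⟩ := mem_iUnion.1 (hKC ⟨hSK x.2, hxG⟩)
        exact mem_iUnion.2 ⟨.inr n, hn⟩)
  obtain ⟨U, hU, hUD⟩ := isOpen_induced_iff.1 (isOpen_interior (s := D o))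
  have hUS : U ∩ S ⊆ Sum.elim G C o := fun y hy => by
    have : (⟨y, subset_closure hy.2⟩ : closure S) ∈ interior (D o) := hUD ▸ hy.1
    exact interior_subset (s := D o) this
  have hxU : x.1 ∈ U := by
    rw [← hUD] at hx
    exact hx
  obtain ⟨y, hy⟩ := mem_closure_iff.1 x.2 U hU hxU
  rcases o with i | n
  · exact (hy.2.2 (mem_iUnion.2 ⟨i, hUS hy⟩)).elim
  · exact ⟨U, hU, n, ⟨y, hy⟩, hUS⟩

/-! ### Alster's property -/

/-- A pressing-down lemma. If for each `δ` of cofinality `ω` some witness `w` of `P w δ` is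
available below `δ`, and only countably many witnesses are available at each stage, then a single
`w` works for unboundedly many `δ`. -/
theorem exists_forall_exists_lt_of_isLUB {I α : Type*} [LinearOrder I] [WellFoundedLT I]
    [Uncountable I] (hI : ∀ i : I, (Iio i).Countable) {𝓦 : I → Set α}
    (h𝓦 : ∀ i, (𝓦 i).Countable) {P : α → I → Prop}
    (hP : ∀ (d : ℕ → I) (δ : I), StrictMono d → IsLUB (range d) δ → ∃ k, ∃ w ∈ 𝓦 (d k), P w δ) :
    ∃ w, ∀ i, ∃ δ, i < δ ∧ P w δ := by
  by_contra! h
  choose b hb using h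
  have h1 : ∀ i, ∃ i', i < i' ∧ ∀ w ∈ 𝓦 i, b w < i' := fun i => by
    obtain ⟨i', hi'⟩ := Set.Countable.exists_forall_lt hI (((h𝓦 i).image b).insert i)
    exact ⟨i', hi' i (mem_insert _ _), fun w hw => hi' _ (Or.inr ⟨w, hw, rfl⟩)⟩
  choose next hlt hnext using h1
  have : Nonempty I := inferInstance
  let d : ℕ → I := fun k => next^[k] (Classical.arbitrary I)
  have hd : ∀ k, d (k + 1) = next (d k) := fun k => Function.iterate_succ_apply' _ _ _
  have hmono : StrictMono d := strictMono_nat_of_lt_succ fun k => by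
    rw [hd]
    exact hlt _
  obtain ⟨u, hu⟩ := Set.Countable.exists_forall_lt hI (countable_range d)
  obtain ⟨δ, hδ, hmin⟩ := (wellFounded_lt (α := I)).has_min (upperBounds (range d))
    ⟨u, fun i hi => (hu i hi).le⟩
  obtain ⟨k, w, hw, hPw⟩ := hP d δ hmono ⟨hδ, fun i hi => not_lt.1 (hmin i hi)⟩
  refine hb w δ ?_ hPw
  exact (hnext _ w hw).trans_le (hd k ▸ hδ ⟨k + 1, rfl⟩)

/-- A point of a product lies in the image of a Lindelöf space if unboundedly many of its initial
restrictions are restrictions of points of the image. -/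
theorem mem_range_of_forall_exists_eqOn {X I : Type*} {J : I → Type*} [TopologicalSpace X]
    [LindelofSpace X] [LinearOrder I] [Uncountable I] (hI : ∀ i : I, (Iio i).Countable)
    [∀ i, TopologicalSpace (J i)] [∀ i, T1Space (J i)] {φ : X → ∀ i, J i} (hφ : Continuous φ)
    {z : ∀ i, J i} (hz : ∀ i, ∃ δ, i < δ ∧ ∃ x, ∀ j < δ, φ x j = z j) : z ∈ range φ := by
  by_contra h
  have h1 : ∀ x, ∃ i, φ x i ≠ z i := fun x => Function.ne_iff.1 fun hx => h ⟨x, hx⟩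
  obtain ⟨c, hc, hcX⟩ := isLindelof_univ.elim_countable_subcover (X := X)
    (fun i => {x | φ x i ≠ z i})
    (fun i => isOpen_compl_singleton.preimage ((continuous_apply i).comp hφ))
    (fun x _ => mem_iUnion.2 (h1 x))
  obtain ⟨i, hi⟩ := Set.Countable.exists_forall_lt hI hc
  obtain ⟨δ, hδ, x, hx⟩ := hz i
  obtain ⟨j, hj, hjx⟩ := mem_iUnion₂.1 (hcX (mem_univ x))
  exact hjx (hx j ((hi j hj).trans hδ))

/-- A basic neighbourhood in the first `δ` coordinates, `δ` a limit of `d`, already depends on the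
first `d k` coordinates for some `k`. -/
theorem exists_mem_countableBasis_restrict {I : Type*} {J : Type*} [LinearOrder I]
    [TopologicalSpace J]
    [∀ i : I, SecondCountableTopology (Iio i → J)] {d : ℕ → I} {δ : I} (hd : StrictMono d)
    (hδ : IsLUB (range d) δ) {U : Set (Iio δ → J)} (hU : IsOpen U) {z : I → J}
    (hz : (Iio δ).domRestrict z ∈ U) :
    ∃ k, ∃ V ∈ TopologicalSpace.countableBasis (Iio (d k) → J),
      (Iio (d k)).domRestrict z ∈ V ∧
        ∀ y : I → J, (Iio (d k)).domRestrict y ∈ V → (Iio δ).domRestrict y ∈ U := by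
  obtain ⟨F, w, hw, hFw⟩ := isOpen_pi_iff.1 hU _ hz
  have h1 : ∀ i : Iio δ, ∃ k, i.1 < d k := fun i => by
    by_contra! h
    exact not_le.2 i.2 (hδ.2 (forall_mem_range.2 h))
  choose m hm using h1
  obtain ⟨k, hk⟩ := (F.image m).bddAbove
  have hFk : ∀ i ∈ F, i.1 < d k := fun i hi =>
    (hm i).trans_le (hd.monotone (hk (Finset.mem_image_of_mem m hi)))
  have hV₀ : IsOpen (⋂ i : F, {y : Iio (d k) → J | y ⟨i.1.1, hFk i.1 i.2⟩ ∈ w i.1}) :=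
    isOpen_iInter_of_finite fun i => (hw i.1 i.2).1.preimage (continuous_apply _)
  obtain ⟨V, hV, hzV, hVV₀⟩ :=
    (TopologicalSpace.isBasis_countableBasis (Iio (d k) → J)).exists_subset_of_mem_open
      (a := (Iio (d k)).domRestrict z) (mem_iInter.2 fun i => (hw i.1 i.2).2) hV₀
  exact ⟨k, V, hV, hzV, fun y hy => hFw fun i hi => mem_iInter.1 (hVV₀ hy) ⟨i, hi⟩⟩

/-- The case of Alster's property in which the family consists of closed `Gδ` sets and is indexed by
`I`. -/
theorem IsProductivelyLindelof.exists_range_subset_of_isGδ {X I : Type u} {J : Type}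
    [TopologicalSpace X] [LinearOrder I] [WellFoundedLT I] [Uncountable I]
    (hI : ∀ i : I, (Iio i).Countable) (hc : 𝔠 ≤ #I) [TopologicalSpace J] [CompactSpace J]
    [T2Space J] [SecondCountableTopology J] (hX : IsProductivelyLindelof X) {φ : X → I → J}
    (hφ : Continuous φ) {H : I → Set (I → J)} (hH : ∀ β, IsClosed (H β)) (hHδ : ∀ β, IsGδ (H β))
    (hcov : ∀ K, IsCompact K → K ⊆ range φ → ∃ β, K ⊆ H β) :
    ∃ i, range φ ⊆ ⋃ j < i, H j := by
  have := hX.isRegularLindelof.lindelof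
  have hIc : ∀ i : I, Countable (Iio i) := fun i => (hI i).to_subtype
  let p : ∀ δ : I, (I → J) → (Iio δ → J) := fun δ => (Iio δ).domRestrict
  have hp : ∀ δ, Continuous (p δ) := fun δ => Pi.continuous_domRestrict _
  have hpeq : ∀ {δ : I} {y z : I → J}, p δ y = p δ z → ∀ i < δ, y i = z i :=
    fun {δ y z} h i hi => congrFun h ⟨i, hi⟩
  choose d hd using fun β => (hH β).isCompact.exists_forall_mem_of_isGδ hI (hHδ β) subset_rfl
  choose A hA hAφ using fun δ =>
    hX.exists_iUnion_eq_range hI hc (φ := fun x => p δ (φ x)) ((hp δ).comp hφ)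
  let O : I → Set (I → J) := fun δ => ⋃ β : {β // β < δ ∧ d β ≤ δ}, H β
  have hOmono : Monotone O := fun γ δ h =>
    iUnion_subset fun β => subset_iUnion_of_subset (ι := {β // β < δ ∧ d β ≤ δ})
      ⟨β.1, β.2.1.trans_le h, β.2.2.trans h⟩ subset_rfl
  have hOsat : ∀ {δ y z}, p δ y = p δ z → y ∈ O δ → z ∈ O δ := fun {δ y z} h hy => by
    obtain ⟨β, hβ⟩ := mem_iUnion.1 hy
    exact mem_iUnion.2 ⟨β, hd β y hβ z fun i hi => (hpeq h i (hi.trans_le β.2.2)).symm⟩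
  have hLin : ∀ (δ : I) (s : Set (I → J)), (∀ y z, p δ y = p δ z → y ∈ s → z ∈ s) →
      IsLindelof s := fun δ s hs => by
    have : s = p δ ⁻¹' (p δ '' s) :=
      (subset_preimage_image _ _).antisymm fun z ⟨y, hy, hyz⟩ => hs y z hyz hy
    rw [this]
    exact (hp δ).isLindelof_preimage _
  let T : I → Set (I → J) := fun δ => {z | z ∉ O δ ∧ p δ z ∉ range fun x => p δ (φ x)}
  have key : ∀ K, IsClosed K → (∀ δ, Disjoint K (T δ)) → ∃ δ, K ⊆ O δ := by
    intro K hK hKT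
    by_contra! hKO
    have hKA : ∀ δ, ∀ k ∈ K, k ∉ O δ → p δ k ∈ ⋃ n, A δ n := fun δ k hk hkO => by
      rw [hAφ]
      by_contra h
      exact (hKT δ).le_bot ⟨hk, hkO, h⟩
    have hB : ∀ δ, ∃ U, IsOpen U ∧ ∃ n, (∃ k ∈ K, k ∉ O δ ∧ p δ k ∈ U) ∧
        ∀ k ∈ K, k ∉ O δ → p δ k ∈ U → p δ k ∈ A δ n := by
      intro δ
      have : Countable {β // β < δ ∧ d β ≤ δ} := ((hI δ).mono fun β hβ => hβ.1).to_subtype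
      have hO : ∀ k, p δ k ∈ ⋃ β : {β // β < δ ∧ d β ≤ δ}, p δ '' H β ↔ k ∈ O δ := fun k => by
        rw [← image_iUnion]
        exact ⟨fun ⟨y, hy, hyk⟩ => hOsat hyk hy, fun hk => ⟨k, hk, rfl⟩⟩
      obtain ⟨k₀, hk₀, hk₀O⟩ := not_subset.1 (hKO δ)
      obtain ⟨U, hU, n, ⟨_, hyU, ⟨k, hk, rfl⟩, hkO⟩, hUn⟩ :=
        ((hp δ).isClosedMap _ hK).exists_isOpen_inter_diff_subset
          (G := fun β : {β // β < δ ∧ d β ≤ δ} => p δ '' H β)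
          (fun β => (hp δ).isClosedMap _ (hH β)) (hA δ)
          ⟨p δ k₀, ⟨k₀, hk₀, rfl⟩, fun h => hk₀O ((hO k₀).1 h)⟩
          (by
            rintro _ ⟨⟨k, hk, rfl⟩, hkO⟩
            exact hKA δ k hk fun h => hkO ((hO k).2 h))
      exact ⟨U, hU, n, ⟨k, hk, fun h => hkO ((hO k).2 h), hyU⟩,
        fun k hk hkO hkU => hUn ⟨hkU, ⟨k, hk, rfl⟩, fun h => hkO ((hO k).1 h)⟩⟩
    -- Press down on the basic open set and the number of the piece.
    let P : Set (I → J) × ℕ → I → Prop := fun w δ =>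
      (∃ k ∈ K, k ∉ O δ ∧ k ∈ w.1) ∧ ∀ k ∈ K, k ∉ O δ → k ∈ w.1 → p δ k ∈ A δ w.2
    obtain ⟨w, hw⟩ := exists_forall_exists_lt_of_isLUB hI (P := P)
      (𝓦 := fun ε => ((p ε ⁻¹' ·) '' TopologicalSpace.countableBasis (Iio ε → J)) ×ˢ Set.univ)
      (fun ε => ((TopologicalSpace.countable_countableBasis _).image _).prod countable_univ)
      (by
        intro e δ he hδ
        obtain ⟨U, hU, n, ⟨k, hk, hkO, hkU⟩, hUn⟩ := hB δ
        obtain ⟨m, V, hV, hkV, hVU⟩ := exists_mem_countableBasis_restrict he hδ hU hkU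
        exact ⟨m, (p (e m) ⁻¹' V, n), ⟨⟨V, hV, rfl⟩, mem_univ _⟩, ⟨k, hk, hkO, hkV⟩,
          fun y hy hyO hyV => hUn y hy hyO (hVU y hyV)⟩)
    -- The cylinders over the pieces `A δ w.2`, for the unboundedly many good `δ`, meet in a compact
    -- subset of the range. A countable subfamily already meets inside the same `H β`.
    let S : Set I := {δ | P w δ}
    let E : S → Set (I → J) := fun δ => p δ ⁻¹' A δ w.2
    have hE : ∀ δ, IsClosed (E δ) := fun δ => (hA δ w.2).preimage (hp δ)
    obtain ⟨β, hβ⟩ := hcov (⋂ δ, E δ) (isClosed_iInter hE).isCompact fun z hz =>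
      mem_range_of_forall_exists_eqOn hI hφ fun i => by
        obtain ⟨δ, hiδ, hδ⟩ := hw i
        have : p δ z ∈ range fun x => p δ (φ x) :=
          hAφ δ ▸ mem_iUnion.2 ⟨w.2, mem_iInter.1 hz ⟨δ, hδ⟩⟩
        obtain ⟨x, hx⟩ := this
        exact ⟨δ, hiδ, x, hpeq hx⟩
    obtain ⟨c, hcc, hcH⟩ := (hLin (d β) (H β)ᶜ fun y z h hy hz =>
      hy (hd β z hz y (hpeq h))).elim_countable_subcover (fun δ => (E δ)ᶜ)
        (fun δ => (hE δ).isOpen_compl) (by rwa [← compl_iInter, compl_subset_compl])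
    obtain ⟨i, hi⟩ := Set.Countable.exists_forall_lt hI
      (((hcc.image Subtype.val).insert β).insert (d β))
    obtain ⟨δ, hiδ, ⟨k, hk, hkO, hkw⟩, -⟩ := hw i
    have hkH : k ∉ H β := fun h => hkO (mem_iUnion.2
      ⟨⟨β, (hi β (Or.inr (Or.inl rfl))).trans hiδ, ((hi _ (Or.inl rfl)).trans hiδ).le⟩, h⟩)
    obtain ⟨γ, hγ, hkγ⟩ := mem_iUnion₂.1 (hcH hkH)
    exact hkγ (γ.2.2 k hk (fun h => hkO (hOmono
      ((hi γ (Or.inr (Or.inr ⟨γ, hγ, rfl⟩))).trans hiδ).le h)) hkw)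
  have hTL : ∀ δ, IsLindelof (T δ) := fun δ => hLin δ _ fun y z h hy =>
    ⟨fun hz => hy.1 (hOsat h.symm hz), h ▸ hy.2⟩
  -- Outside `O δ` only initial coordinates matter, and inside `O δ` only countably many `T γ` do.
  have hT : IsLindelof (⋃ δ, T δ) := by
    refine isLindelof_of_countable_subcover fun {ι} U hU hTU => ?_
    obtain ⟨δ, hδ⟩ := key (⋃ k, U k)ᶜ (isOpen_iUnion hU).isClosed_compl
      fun δ => disjoint_compl_left.mono_right ((subset_iUnion T δ).trans hTU)
    have hL : IsLindelof ((O δ)ᶜ ∪ ⋃ γ ∈ Iio δ, T γ) :=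
      (hLin δ (O δ)ᶜ fun y z h hy hz => hy (hOsat h.symm hz)).union
        ((hI δ).isLindelof_biUnion fun γ _ => hTL γ)
    obtain ⟨c, hcc, hcU⟩ := hL.elim_countable_subcover U hU
      (union_subset (compl_subset_comm.1 hδ)
        (iUnion₂_subset fun γ _ => (subset_iUnion T γ).trans hTU))
    refine ⟨c, hcc, (iUnion_subset fun γ z hz => ?_).trans hcU⟩
    rcases lt_or_ge γ δ with h | h
    · exact Or.inr (mem_biUnion h hz)
    · exact Or.inl fun hz' => hz.1 (hOmono h hz')
  refine hX.exists_range_subset hI hφ hT ?_ H fun V hV hTV => ?_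
  · rw [Set.disjoint_left]
    rintro _ hz ⟨x, rfl⟩
    obtain ⟨δ, hδ⟩ := mem_iUnion.1 hz
    exact hδ.2 ⟨x, rfl⟩
  · obtain ⟨δ, hδ⟩ := key Vᶜ hV.isClosed_compl
      fun δ => disjoint_compl_left.mono_right ((subset_iUnion T δ).trans hTV)
    exact ⟨δ, hδ.trans (iUnion_subset fun β => subset_biUnion_of_mem (u := H) β.2.1)⟩

/-- *Alster's property* of a subset `Q` of a space: every family of `Gδ` sets of the ambient space
which captures each compact subset of `Q` in one member has a countable subfamily covering `Q`. As
`Gδ` sets of the subspace `Q` are traces of `Gδ` sets of the ambient space, this does not depend on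
the ambient space. -/
def HasAlsterProperty {Z : Type*} [TopologicalSpace Z] (Q : Set Z) : Prop :=
  ∀ 𝒢 : Set (Set Z), (∀ G ∈ 𝒢, IsGδ G) → (∀ K, IsCompact K → K ⊆ Q → ∃ G ∈ 𝒢, K ⊆ G) →
    ∃ 𝒞 ⊆ 𝒢, 𝒞.Countable ∧ Q ⊆ ⋃₀ 𝒞

theorem IsProductivelyLindelof.hasAlsterProperty_range {X I : Type u} {J : Type}
    [TopologicalSpace X] [LinearOrder I] [WellFoundedLT I] [Uncountable I]
    (hI : ∀ i : I, (Iio i).Countable) (hc : #I = 𝔠) [TopologicalSpace J] [CompactSpace J]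
    [T2Space J] [SecondCountableTopology J] (hX : IsProductivelyLindelof X) {φ : X → I → J}
    (hφ : Continuous φ) : HasAlsterProperty (range φ) := by
  intro 𝒢 hGδ hcov
  have hIc : ∀ i : I, Countable (Iio i) := fun i => (hI i).to_subtype
  let p : ∀ δ : I, (I → J) → (Iio δ → J) := fun δ => (Iio δ).domRestrict
  have hp : ∀ δ, Continuous (p δ) := fun δ => Pi.continuous_domRestrict _
  have hcyl : ∀ {K G : Set (I → J)}, IsCompact K → IsGδ G → K ⊆ G →
      ∃ δ, p δ ⁻¹' (p δ '' K) ⊆ G := fun {K G} hK hG hKG => by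
    obtain ⟨δ, hδ⟩ := hK.exists_forall_mem_of_isGδ hI hG hKG
    exact ⟨δ, fun z ⟨k, hk, hkz⟩ => hδ k hk z fun i hi => (congrFun hkz ⟨i, hi⟩).symm⟩
  -- Shrink the family to closed cylinders, of which there are only `𝔠` many.
  let 𝒮 : Set (Set (I → J)) := {C | IsClosed C ∧ IsGδ C ∧ ∃ G ∈ 𝒢, C ⊆ G}
  have h𝒮 : #𝒮 ≤ #I := by
    have : 𝒮 ⊆ ⋃ δ, (p δ ⁻¹' ·) '' {B : Set (Iio δ → J) | IsClosed B} := fun C ⟨hC, hCδ, _⟩ => by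
      obtain ⟨δ, hδ⟩ := hcyl hC.isCompact hCδ subset_rfl
      exact mem_iUnion.2 ⟨δ, p δ '' C, (hp δ).isClosedMap _ hC,
        hδ.antisymm (subset_preimage_image _ _)⟩
    refine (mk_le_mk_of_subset this).trans ((mk_iUnion_le _).trans ?_)
    rw [hc]
    exact (mul_le_mul_right (ciSup_le' fun δ => mk_image_le.trans (mk_setOf_isClosed_le _)) _).trans
      continuum_mul_self.le
  obtain ⟨G₀, hG₀, -⟩ := hcov ∅ isCompact_empty (empty_subset _)
  obtain ⟨H, hH⟩ := Cardinal.exists_range_eq (S := 𝒮)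
    ⟨∅, isClosed_empty, IsGδ.empty, G₀, hG₀, empty_subset _⟩ h𝒮
  have hH' : ∀ i, H i ∈ 𝒮 := fun i => hH ▸ ⟨i, rfl⟩
  obtain ⟨i, hi⟩ := hX.exists_range_subset_of_isGδ hI hc.ge hφ (fun β => (hH' β).1)
    (fun β => (hH' β).2.1) fun K hK hKφ => by
      obtain ⟨G, hG, hKG⟩ := hcov K hK hKφ
      obtain ⟨δ, hδ⟩ := hcyl hK (hGδ G hG) hKG
      have hcl : IsClosed (p δ '' K) := (hK.image (hp δ)).isClosed
      have : p δ ⁻¹' (p δ '' K) ∈ range H :=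
        hH ▸ ⟨hcl.preimage (hp δ), hcl.isGδ.preimage (hp δ), G, hG, hδ⟩
      obtain ⟨β, hβ⟩ := this
      exact ⟨β, hβ ▸ subset_preimage_image _ _⟩
  choose G hG hHG using fun i => (hH' i).2.2
  refine ⟨G '' Iio i, image_subset_iff.2 fun j _ => hG j, (hI i).image G, fun z hz => ?_⟩
  obtain ⟨j, hj, hzj⟩ := mem_iUnion₂.1 (hi hz)
  exact ⟨G j, ⟨j, hj, rfl⟩, hHG j hzj⟩

/-! ### Countable powers -/

/-- The tube lemma in the first `n` factors of a countable product of compact sets. -/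
theorem exists_isOpen_pi_prefix_subset {Z : Type*} [TopologicalSpace Z] {K : ℕ → Set Z}
    (hK : ∀ i, IsCompact (K i)) {U : Set (ℕ → Z)} (hU : IsOpen U) (hKU : Set.univ.pi K ⊆ U)
    (n : ℕ) :
    ∃ V : ℕ → Set Z, (∀ i, IsOpen (V i)) ∧ (∀ i < n, K i ⊆ V i) ∧ ∃ W : Set (ℕ → Z), IsOpen W ∧
      (Set.univ.pi fun i => K (i + n)) ⊆ W ∧
      ∀ z : ℕ → Z, (∀ i < n, z i ∈ V i) → (fun i => z (i + n)) ∈ W → z ∈ U := by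
  induction n with
  | zero => exact ⟨fun _ => ∅, fun _ => isOpen_empty, by simp, U, hU, hKU, fun z _ hz => hz⟩
  | succ n ih =>
    obtain ⟨V, hV, hKV, W, hW, hKW, hVW⟩ := ih
    let f : Z × (ℕ → Z) → ℕ → Z := fun y i => Nat.casesOn i y.1 y.2
    have hf : Continuous f := continuous_pi fun i => by
      cases i with
      | zero => exact continuous_fst
      | succ i => exact (continuous_apply i).comp continuous_snd
    obtain ⟨V', W', hV', hW', hKV', hKW', hVW'⟩ := generalized_tube_lemma (hK n)
      (isCompact_univ_pi fun i => hK (i + (n + 1))) (hW.preimage hf) (by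
        rintro ⟨a, y⟩ ⟨ha, hy⟩
        refine hKW fun i _ => ?_
        cases i with
        | zero => simpa [f] using ha
        | succ i =>
          have : y i ∈ K (i + (n + 1)) := hy i trivial
          rwa [show i + (n + 1) = i + 1 + n by omega] at this)
    refine ⟨Function.update V n V', fun i => ?_, fun i hi => ?_, W', hW', hKW',
      fun z hz hzW => hVW z (fun i hi => ?_) ?_⟩
    · rcases eq_or_ne i n with rfl | h
      · rwa [Function.update_self]
      · rw [Function.update_of_ne h]
        exact hV i
    · rcases eq_or_ne i n with rfl | h
      · rwa [Function.update_self]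
      · rw [Function.update_of_ne h]
        exact hKV i (by omega)
    · have := hz i (by omega)
      rwa [Function.update_of_ne hi.ne] at this
    · have hn := hz n (by omega)
      rw [Function.update_self] at hn
      have h : f (z n, fun i => z (i + (n + 1))) ∈ W := hVW' ⟨hn, hzW⟩
      convert h using 1
      funext i
      cases i with
      | zero => simp [f]
      | succ i => simp only [f]; congr 1; omega

/-- The tube lemma for a countable product of nonempty compact sets. -/
theorem exists_isOpen_forall_lt_mem_imp_mem {Z : Type*} [TopologicalSpace Z] {K : ℕ → Set Z}
    (hK : ∀ i, IsCompact (K i)) (hne : ∀ i, (K i).Nonempty) {U : Set (ℕ → Z)} (hU : IsOpen U)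
    (hKU : Set.univ.pi K ⊆ U) :
    ∃ n, ∃ V : ℕ → Set Z, (∀ i, IsOpen (V i)) ∧ (∀ i < n, K i ⊆ V i) ∧
      ∀ z : ℕ → Z, (∀ i < n, z i ∈ V i) → z ∈ U := by
  choose F w hw hFw using fun k : Set.univ.pi K => isOpen_pi_iff.1 hU k.1 (hKU k.2)
  have hop : ∀ k, IsOpen ((F k : Set ℕ).pi (w k)) := fun k =>
    isOpen_set_pi (F k).finite_toSet fun i hi => (hw k i hi).1
  obtain ⟨t, ht⟩ := (isCompact_univ_pi hK).elim_finite_subcover _ hop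
    fun k hk => mem_iUnion.2 ⟨⟨k, hk⟩, fun i hi => (hw _ i hi).2⟩
  obtain ⟨m, hm⟩ := (t.biUnion F).bddAbove
  obtain ⟨V, hV, hKV, W, hW, hKW, hVW⟩ := exists_isOpen_pi_prefix_subset hK
    (isOpen_biUnion fun k (_ : k ∈ t) => hop k) ht (m + 1)
  refine ⟨m + 1, V, hV, hKV, fun z hz => ?_⟩
  choose y hy using hne
  obtain ⟨k, hk, hzk⟩ := mem_iUnion₂.1 (hVW (fun i => if i < m + 1 then z i else y i)
    (fun i hi => by simpa [hi] using hz i hi) (hKW fun i _ => by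
      have : ¬ i + (m + 1) < m + 1 := by omega
      simpa only [this, if_false] using hy _))
  refine hFw k fun i hi => ?_
  have him : i < m + 1 := Nat.lt_succ_of_le (hm (Finset.mem_biUnion.2 ⟨k, hk, hi⟩))
  have := hzk i hi
  simpa only [him, if_true] using this

/-- If no countable part of a cover of `Q ^ ω` covers it, Alster's property yields successively
compact sets `K 0, K 1, … ⊆ Q` such that for no `n` is a `Gδ` box around `K 0 × ⋯ × K (n - 1)`
countably covered. But `∏ K i` is compact, so a finite part of the cover contains an open box around
it. -/
theorem HasAlsterProperty.isLindelof_pi {Z : Type*} [TopologicalSpace Z] {Q : Set Z}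
    (hQ : HasAlsterProperty Q) : IsLindelof (Set.univ.pi fun _ : ℕ => Q) := by
  refine isLindelof_of_countable_subcover fun {ι} U hU hQU => ?_
  let cov : Set (ℕ → Z) → Prop := fun s => ∃ c : Set ι, c.Countable ∧ s ⊆ ⋃ k ∈ c, U k
  let box : ℕ → (ℕ → Set Z) → Set (ℕ → Z) := fun n G => {q | (∀ i, q i ∈ Q) ∧ ∀ i < n, q i ∈ G i}
  let bad : ℕ → (ℕ → Set Z) → Prop := fun n K =>
    ∀ G : ℕ → Set Z, (∀ i, IsGδ (G i)) → (∀ i < n, K i ⊆ G i) → ¬ cov (box n G)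
  have step : ∀ n K, ∃ L, IsCompact L ∧ L ⊆ Q ∧
      (bad n K → bad (n + 1) (Function.update K n L)) := by
    intro n K
    by_cases hK : bad n K
    swap
    · exact ⟨∅, isCompact_empty, empty_subset _, fun h => (hK h).elim⟩
    by_contra! hcon
    let 𝒢 : Set (Set Z) := {L | ∃ G : ℕ → Set Z, (∀ i, IsGδ (G i)) ∧ (∀ i < n, K i ⊆ G i) ∧
      G n = L ∧ cov (box (n + 1) G)}
    obtain ⟨𝒞, h𝒞, h𝒞c, hQ𝒞⟩ := hQ 𝒢 (by
      rintro _ ⟨G, hG, -, rfl, -⟩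
      exact hG n) fun L hL hLQ => by
        have := (hcon L hL hLQ).2
        simp only [bad] at this
        push Not at this
        obtain ⟨G, hG, hKG, hcG⟩ := this
        refine ⟨G n, ⟨G, hG, fun i hi => ?_, rfl, hcG⟩, ?_⟩
        · simpa [Function.update_of_ne hi.ne] using hKG i (by omega)
        · simpa using hKG n (by omega)
    have h𝒞' : ∀ L ∈ 𝒞, ∃ G : ℕ → Set Z, (∀ i, IsGδ (G i)) ∧ (∀ i < n, K i ⊆ G i) ∧
      G n = L ∧ cov (box (n + 1) G) := h𝒞
    choose! G hG hKG hGn hcG using h𝒞'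
    choose! c hc hcU using hcG
    refine hK (fun i => ⋂ L ∈ 𝒞, G L i) (fun i => IsGδ.biInter h𝒞c fun L hL => hG L hL i)
      (fun i hi => subset_iInter₂ fun L hL => hKG L hL i hi)
      ⟨⋃ L ∈ 𝒞, c L, h𝒞c.biUnion fun L hL => hc L hL, ?_⟩
    rintro q ⟨hqQ, hq⟩
    obtain ⟨L, hL, hqL⟩ := hQ𝒞 (hqQ n)
    have : q ∈ box (n + 1) (G L) := ⟨hqQ, fun i hi => by
      rcases Nat.lt_succ_iff_lt_or_eq.1 hi with h | rfl
      · exact mem_iInter₂.1 (hq i h) L hL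
      · rwa [hGn L hL]⟩
    obtain ⟨k, hk, hqk⟩ := mem_iUnion₂.1 (hcU L hL this)
    exact mem_biUnion (mem_biUnion hL hk) hqk
  by_contra hnot
  choose L hLc hLQ hL using step
  let s : ℕ → ℕ → Set Z := fun n => Nat.rec (fun _ => ∅) (fun n K => Function.update K n (L n K)) n
  have hs : ∀ n, s (n + 1) = Function.update (s n) n (L n (s n)) := fun n => rfl
  let K : ℕ → Set Z := fun n => L n (s n)
  have hsK : ∀ n, ∀ i < n, s n i = K i := by
    intro n
    induction n with
    | zero => intro i hi; omega
    | succ n ih =>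
      intro i hi
      rw [hs]
      rcases eq_or_ne i n with rfl | h
      · rw [Function.update_self]
      · rw [Function.update_of_ne h, ih i (by omega)]
  have hbad : ∀ n, bad n (s n) := by
    intro n
    induction n with
    | zero =>
      rintro G - - ⟨c, hc, hcU⟩
      exact hnot ⟨c, hc, fun q hq => hcU ⟨fun i => hq i trivial, by simp⟩⟩
    | succ n ih => exact hs n ▸ hL n _ ih
  -- The box around an empty factor can be taken empty, so it would be covered.
  have hne : ∀ i, (K i).Nonempty := fun i => by
    by_contra h
    rw [not_nonempty_iff_eq_empty] at h
    refine hbad (i + 1) (fun j => if j = i then ∅ else Set.univ) (fun j => ?_) (fun j hj => ?_)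
      ⟨∅, countable_empty, fun q hq => ?_⟩
    · split_ifs
      exacts [IsGδ.empty, IsGδ.univ]
    · rw [hsK _ j hj]
      split_ifs with hji
      · rw [hji, h]
      · exact subset_univ _
    · simpa using hq.2 i (by omega)
  have hKc : ∀ i, IsCompact (K i) := fun i => hLc _ _
  obtain ⟨t, ht⟩ := (isCompact_univ_pi hKc).elim_finite_subcover U hU
    fun k hk => hQU fun i _ => hLQ _ _ (hk i trivial)
  obtain ⟨n, V, hV, hKV, hVU⟩ := exists_isOpen_forall_lt_mem_imp_mem hKc hne
    (isOpen_biUnion fun k (_ : k ∈ t) => hU k) ht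
  exact hbad n V (fun i => (hV i).isGδ) (fun i hi => hsK n i hi ▸ hKV i hi)
    ⟨t, t.countable_toSet, fun q hq => hVU q hq.2⟩

/-- A cover of `F ^ ω` by boxes of sets `e j ⁻¹' V`, in which only the functions `e j`, `j : I`, are
involved, comes from a cover of a power of the image of `F` in `I → J`. -/
theorem IsProductivelyLindelof.exists_countable_cover {F I κ : Type u} {J : Type}
    [TopologicalSpace F] [LinearOrder I] [WellFoundedLT I] [Uncountable I]
    (hI : ∀ i : I, (Iio i).Countable) (hc : #I = 𝔠) [TopologicalSpace J] [CompactSpace J]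
    [T2Space J] [SecondCountableTopology J] (hF : IsProductivelyLindelof F)
    {e : I → F → J} (he : ∀ i, Continuous (e i)) (V : Set J) (hV : IsOpen V)
    (n : κ → ℕ) (s : κ → ℕ → I)
    (hcov : ∀ y : ℕ → F, ∃ k, ∀ i < n k, e (s k i) (y i) ∈ V) :
    ∃ c : Set κ, c.Countable ∧ ∀ y : ℕ → F, ∃ k ∈ c, ∀ i < n k, e (s k i) (y i) ∈ V := by
  obtain ⟨c, hc, hcU⟩ := (hF.hasAlsterProperty_range hI hc (φ := fun x i => e i x)
    (continuous_pi he)).isLindelof_pi.elim_countable_subcover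
      (fun k : κ => ⋂ i ∈ Iio (n k), {z : ℕ → I → J | z i (s k i) ∈ V})
      (fun k => (finite_Iio (n k)).isOpen_biInter fun i _ =>
        hV.preimage (f := fun z : ℕ → I → J => z i (s k i))
          ((continuous_apply _).comp (continuous_apply i)))
      (fun z hz => by
        choose y hy using fun i => hz i trivial
        obtain ⟨k, hk⟩ := hcov y
        exact mem_iUnion.2 ⟨k, mem_iInter₂.2 fun i hi => by
          have : z i (s k i) ∈ V := by
            rw [← hy]
            exact hk i hi
          exact this⟩)
  refine ⟨c, hc, fun y => ?_⟩
  obtain ⟨k, hk, hyk⟩ := mem_iUnion₂.1 (hcU (show (fun i j => e j (y i)) ∈ _ from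
    fun i _ => ⟨y i, rfl⟩))
  exact ⟨k, hk, fun i hi => mem_iInter₂.1 hyk i hi⟩

/-! ### Reflection to a subspace of density at most `𝔠` -/

/-- In every universe, `CH` provides a copy of `ω₁` of cardinality `𝔠`. -/
theorem ContinuumHypothesis.exists_linearOrder (hCH : ContinuumHypothesis) :
    ∃ (I : Type u) (_ : LinearOrder I), WellFoundedLT I ∧ Uncountable I ∧
      (∀ i : I, (Iio i).Countable) ∧ #I = 𝔠 := by
  have hc : continuum.{u} = aleph 1 := by
    have := congrArg lift.{u} hCH
    rwa [lift_continuum, lift_aleph, Ordinal.lift_one] at this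
  have hI : #(continuum.{u}.ord.ToType) = 𝔠 := mk_ord_toType _
  refine ⟨continuum.{u}.ord.ToType, inferInstance, inferInstance, ?_, fun i => ?_, hI⟩
  · rw [← aleph0_lt_mk_iff, hI]
    exact aleph0_lt_continuum
  · rw [← le_aleph0_iff_set_countable, ← Order.lt_succ_iff, succ_aleph0, ← hc]
    exact (mk_Iio_lt i (by rw [hI, Ordinal.type_toType])).trans_eq hI

/-- Closing off under `𝔠` many operations of countable arity: the set generated is the image of the
type of well-founded terms. -/
theorem exists_set_closed_under_operations {X : Type u} [Nonempty X] {Θ : Type} (hΘ : #Θ ≤ 𝔠)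
    (op : Θ → (ℕ → X) → X) :
    ∃ D : Set X, D.Nonempty ∧ #D ≤ 𝔠 ∧ ∀ θ b, (∀ k, b k ∈ D) → op θ b ∈ D := by
  let β : Option Θ → Type := fun o => o.elim Empty fun _ => ℕ
  let ev : WType β → X := WType.elim X fun p => match p with
    | ⟨none, _⟩ => Classical.arbitrary X
    | ⟨some θ, b⟩ => op θ b
  have hW : #(WType β) ≤ 𝔠 := WType.cardinalMk_le_of_le <| by
    refine (sum_le_sum _ (fun _ => 𝔠) fun o => ?_).trans ?_
    · cases o with
      | none => simpa [β] using (one_le_aleph0.trans aleph0_le_continuum)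
      | some θ => simp [β]
    · rw [sum_const', mk_option]
      exact (mul_le_mul_left (add_le_of_le aleph0_le_continuum hΘ
        (one_le_aleph0.trans aleph0_le_continuum)) _).trans continuum_mul_self.le
  refine ⟨range ev, ⟨_, WType.mk none Empty.elim, rfl⟩, ?_, fun θ b hb => ?_⟩
  · have := mk_range_le_lift (f := ev)
    rw [← lift_le.{0}]
    exact this.trans (by simpa using lift_le.{u}.2 hW)
  · choose t ht using hb
    obtain rfl : (fun k => ev (t k)) = b := funext ht
    exact ⟨WType.mk (some θ) t, rfl⟩

theorem ContinuousMap.mk_le_continuum_of_denseRange {S : Type u} [TopologicalSpace S] {b : ℕ → S}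
    (hb : DenseRange b) : #C(S, unitInterval) ≤ 𝔠 := by
  have hinj : Function.Injective fun (g : C(S, unitInterval)) (n : ℕ) => g (b n) := fun g h hgh =>
    DFunLike.coe_injective (hb.equalizer g.continuous h.continuous hgh)
  have h : #unitInterval ≤ 𝔠 := (mk_set_le _).trans_eq mk_real
  have h' : #(ℕ → unitInterval) ≤ 𝔠 := by
    simpa using power_le_power_right (c := ℵ₀) h
  have := (lift_mk_le_lift_mk_of_injective hinj).trans (lift_le.2 h')
  simpa using this

theorem theorem3p3 (hCH : ContinuumHypothesis) (X : Type u) [TopologicalSpace X]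
    (hX : IsProductivelyLindelof X) (ht : HasCountableTightness X) :
    IsPowerfullyLindelof X := by
  have := hX.isRegularLindelof.regular
  have := hX.isRegularLindelof.lindelof
  refine ⟨inferInstance, isLindelof_univ_iff.1 ?_⟩
  refine isLindelof_of_countable_subcover fun {ι} U hU hXU => ?_
  rcases isEmpty_or_nonempty X with hX₀ | hX₀
  · exact ⟨∅, countable_empty, fun y _ => (IsEmpty.false (y 0)).elim⟩
  obtain ⟨I, _, _, _, hI, hc⟩ := hCH.exists_linearOrder
  -- The functions below vanish at the points to be captured, so `V` omits `1` instead of `0`.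
  let V : Set unitInterval := {1}ᶜ
  have hV : IsOpen V := isOpen_compl_singleton
  let box : ℕ × (ℕ → C(X, unitInterval)) → Set (ℕ → X) := fun q =>
    {y | ∀ i < q.1, q.2 i (y i) ∈ V}
  let P : Type u := {q : ℕ × (ℕ → C(X, unitInterval)) // ∃ k, box q ⊆ U k}
  have hP : ∀ y : ℕ → X, ∃ q : P, y ∈ box q := by
    intro y
    obtain ⟨k, hk⟩ := mem_iUnion.1 (hXU (mem_univ y))
    obtain ⟨F, w, hw, hFw⟩ := isOpen_pi_iff.1 (hU k) y hk
    obtain ⟨m, hm⟩ := F.bddAbove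
    have hg : ∀ i, ∃ g : C(X, unitInterval), g (y i) ∈ V ∧ (i ∈ F → ∀ x, g x ∈ V → x ∈ w i) := by
      intro i
      by_cases hi : i ∈ F
      · obtain ⟨g, hgc, hg0, hg1⟩ := CompletelyRegularSpace.completely_regular_isOpen
          (y i) (w i) (hw i hi).1 (hw i hi).2
        refine ⟨⟨g, hgc⟩, ?_, fun _ x hx => by_contra fun hxw => hx (hg1 hxw)⟩
        simp [V, hg0]
      · exact ⟨ContinuousMap.const X 0, by simp [V], fun h => (hi h).elim⟩
    choose g hgy hgw using hg
    exact ⟨⟨(m + 1, g), k, fun z hz => hFw fun i hi =>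
      hgw i hi _ (hz i (Nat.lt_succ_of_le (hm hi)))⟩, fun i _ => hgy i⟩
  have hA : ∀ b : ℕ → X, ∃ a : ℕ → P, ∀ y : ℕ → X, (∀ i, y i ∈ closure (range b)) →
      ∃ m, y ∈ box (a m) := by
    intro b
    let b' : ℕ → closure (range b) := fun n => ⟨b n, subset_closure ⟨n, rfl⟩⟩
    have hb' : DenseRange b' := by
      rw [DenseRange, Subtype.dense_iff, ← range_comp]
      exact subset_rfl
    obtain ⟨e, he⟩ := exists_range_eq (I := I)
      (S := Set.univ (α := C(closure (range b), unitInterval)))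
      univ_nonempty (by
        rw [mk_univ, hc]
        exact ContinuousMap.mk_le_continuum_of_denseRange hb')
    choose s hs using fun (g : C(X, unitInterval)) =>
      (he ▸ mem_univ (g.comp ⟨Subtype.val, continuous_subtype_val⟩) : _ ∈ range e)
    have hs' : ∀ g x, e (s g) x = g x.1 := fun g x => DFunLike.congr_fun (hs g) x
    obtain ⟨c, hcc, hcov⟩ := (hX.subtype (isClosed_closure (s := range b))).exists_countable_cover
      hI hc (fun i => (e i).continuous) V hV (fun q : P => q.1.1) (fun q i => s (q.1.2 i))
      (fun y => by
        obtain ⟨q, hq⟩ := hP fun i => y i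
        exact ⟨q, fun i hi => (hs' _ _).symm ▸ hq i hi⟩)
    have hcne : c.Nonempty := by
      obtain ⟨q, hq, -⟩ := hcov b'
      exact ⟨q, hq⟩
    obtain ⟨a, rfl⟩ := hcc.exists_eq_range hcne
    refine ⟨a, fun y hy => ?_⟩
    obtain ⟨_, ⟨m, rfl⟩, hm⟩ := hcov fun i => ⟨y i, hy i⟩
    exact ⟨m, fun i hi => by simpa only [hs'] using hm i hi⟩
  choose A hA using hA
  -- `Z v` is a point missed by the boxes in `v` if there is one, and arbitrary otherwise.
  have hZ : ∀ v : ℕ → P, ∃ z : ℕ → X, (∃ m, z ∈ box (v m)) → ∀ y, ∃ m, y ∈ box (v m) := fun v => by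
    by_cases h : ∀ y, ∃ m, y ∈ box (v m)
    · exact ⟨fun _ => Classical.arbitrary X, fun _ => h⟩
    · push Not at h
      obtain ⟨z, hz⟩ := h
      exact ⟨z, fun ⟨m, hm⟩ => (hz m hm).elim⟩
  choose Z hZ using hZ
  -- A sequence of sequences in `D` is coded as a single sequence through the pairing function.
  obtain ⟨D, hDne, hDc, hD⟩ := exists_set_closed_under_operations (Θ := (ℕ → ℕ) × ℕ) (by simp)
    fun θ (b : ℕ → X) => Z (fun k => A (fun i => b (Nat.pair k i)) (θ.1 k)) θ.2
  have : Nonempty D := hDne.to_subtype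
  let κ : Type u := (ℕ → D) × ℕ
  let v : κ → P := fun k => A (fun i => k.1 i) k.2
  obtain ⟨e, he⟩ := exists_range_eq (I := I) (S := range fun k : κ × ℕ => (v k.1).1.2 k.2)
    (range_nonempty _) (mk_range_le.trans (by
      rw [hc]
      have : #(ℕ → D) ≤ 𝔠 := by
        simpa using power_le_power_right (c := ℵ₀) hDc
      have : #(ℕ → D) * ℵ₀ * ℵ₀ ≤ 𝔠 := by
        rw [mul_assoc, aleph0_mul_aleph0]
        exact (mul_le_mul' this aleph0_le_continuum).trans continuum_mul_self.le
      simpa [κ] using this))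
  choose s hs using fun (k : κ) (i : ℕ) => (he ▸ ⟨(k, i), rfl⟩ : (v k).1.2 i ∈ range e)
  obtain ⟨c, hcc, hcov⟩ := (hX.subtype (isClosed_closure (s := D))).exists_countable_cover
    hI hc (fun i => (e i).continuous.comp continuous_subtype_val) V hV (fun k : κ => (v k).1.1) s
    (fun y => by
      choose B hBD hBc hyB using fun i => ht D (y i) (y i).2
      have hne : (⋃ i, B i).Nonempty := by
        obtain ⟨x, hx⟩ := closure_nonempty_iff.1 ⟨_, hyB 0⟩
        exact ⟨x, mem_iUnion.2 ⟨0, hx⟩⟩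
      obtain ⟨b, hb⟩ := (countable_iUnion hBc).exists_eq_range hne
      have hbD : ∀ k, b k ∈ D := fun k => iUnion_subset hBD (hb ▸ ⟨k, rfl⟩)
      obtain ⟨m, hm⟩ := hA b (fun i => y i) fun i =>
        closure_mono (hb ▸ subset_iUnion B i) (hyB i)
      exact ⟨(fun k => ⟨b k, hbD k⟩, m), fun i hi => by
        simp only [Function.comp_apply, hs]
        exact hm i hi⟩)
  have hcne : c.Nonempty := by
    obtain ⟨q, hq, -⟩ := hcov fun _ => ⟨hDne.some, subset_closure hDne.some_mem⟩
    exact ⟨q, hq⟩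
  obtain ⟨t, rfl⟩ := hcc.exists_eq_range hcne
  -- The selected boxes cover `D ^ ω`, which contains the point they would have to miss.
  have hall : ∀ y, ∃ m, y ∈ box (v (t m)) := by
    refine hZ (fun m => v (t m)) ?_
    have hmem : ∀ j, Z (fun m => v (t m)) j ∈ D := fun j => by
      have := hD (fun k => (t k).2, j) (fun l => (t l.unpair.1).1 l.unpair.2)
        fun l => Subtype.prop _
      simpa using this
    obtain ⟨_, ⟨m, rfl⟩, hm⟩ := hcov fun i => ⟨_, subset_closure (hmem i)⟩
    exact ⟨m, fun i hi => by
      have := hm i hi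
      simp only [Function.comp_apply, hs] at this
      exact this⟩
  choose f hf using fun q : P => q.2
  refine ⟨range fun m => f (v (t m)), countable_range _, fun y _ => ?_⟩
  obtain ⟨m, hm⟩ := hall y
  exact mem_biUnion ⟨m, rfl⟩ (hf _ hm)
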